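/- Let $n\in\mathbb N$, let $a^i_{jk}$ ($1\le i,j,k\le n$) be real constants, and let $T,K_1,\dots,K_n$ be smooth functions of $(t,x,p)=(t,x_1,\dots,x_n,p_1,\dots,p_n)$ on an open set $U\subseteq J^1(\mathbb R,\mathbb R^n)=\mathbb R\times\mathbb R^n\times\mathbb R^n$. Put $Q_i=\sum_{j,k}K_j(a^i_{jk}+a^i_{kj})x_k$ and consider the general contact symmetry generator $$v=T\frac{\partial}{\partial t}+\sum_{i=1}^n\Big(K_i\frac{\partial}{\partial x_i}+Q_i\frac{\partial}{\partial p_i}\Big)$$ of the quadratic homogeneous system $\dot x_i=\sum_{j,k}a^i_{jk}x_jx_k$, with its characteristic system $$\frac{dt}{T}=\frac{dx_i}{K_i}=\frac{dp_j}{Q_j}\qquad(1\le i,j\le n).$$ A first integral on an open set is a function that is constant along every integral curve of $v$ in that set. A complete system of first integrals on an open set $W$ is a family of $2n$ smooth first integrals $I_1,\dots,I_{2n}$ on $W$ whose differentials are linearly independent at every point of $W$. (1) Every point of $U$ at which $v\neq0$ has an open neighbourhood in $U$ on which a complete system of first integrals exists. (2) Let $W\subseteq U$ be open. If $I_1,\dots,I_{2n}$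 are functions on $W$ given by the integrals $$I_i=\int(K_i\,dt-T\,dx_i),\qquad I_{n+i}=\int(Q_i\,dt-T\,dp_i)\qquad(1\le i\le n),$$ that is, $dI_i=K_i\,dt-T\,dx_i$ and $dI_{n+i}=Q_i\,dt-T\,dp_i$ on $W$, then they are first integrals on $W$, and they form a complete system if $T\ne0$ on $W$. More generally, denote these $2n$ integrands by $\theta_1,\dots,\theta_{2n}$. If $T\neq0$ on $W$, then smooth functions $I_1,\dots,I_{2n}$ on $W$ form a complete system of first integrals if and only if $dI_\alpha=\sum_\beta M_{\alpha\beta}\theta_\beta$ on $W$ for a pointwise invertible matrix $M$ of smooth functions on $W$ (integrating factors). (3) A differentiable function $S$ on an open subset of $U$ is a first integral there if and only if it solves the linear first order equation $$v[S]=T\frac{\partial S}{\partial t}+\sum_{i=1}^n\Big(K_i\frac{\partial S}{\partial x_i}+Q_i\frac{\partial S}{\partial p_i}\Big)=0 .$$ (4) Let $W\subseteq U$ be open with $v\neq0$ on $W$, let $I=(I_1,\dots,I_{2n})$ be a complete system of first integrals on $W$, and let $1\le r\le\infty$ be arbitrary. For every $C^r$ function $\varphi$ on an open subset of $\mathbb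 R^{2n}$, the function $S=\varphi(I_1,\dots,I_{2n})$ satisfies $v[S]=0$ wherever it is defined. Conversely, every point of $W$ has arbitrarily small open neighbourhoods $N$, independent of $r$, such that $I(N)$ is open and the $C^r$ solutions of $v[S]=0$ on $N$ are exactly the functions $S=\varphi(I_1,\dots,I_{2n})$ with $\varphi$ an arbitrary $C^r$ function on $I(N)$. (5) Let $1\le r\le\infty$, and let $S$ be a $C^r$ solution of $v[S]=0$ on an open set $N\subseteq U$. If $S(q)=0$ and $\frac{\partial S}{\partial t}(q)\neq0$ at a point $q\in N$, then there are open sets $A\subseteq\mathbb R$ and $B\subseteq\mathbb R^{2n}$ with $q\in A\times B\subseteq N$ and a $C^r$ function $\gamma:B\to A$ such that, on $A\times B$, the equation $S(t,x,p)=0$ is equivalent to $t=\gamma(x,p)$. Moreover $\gamma$ satisfies $$T=\sum_{i=1}^n\Big(K_i\frac{\partial\gamma}{\partial x_i}+Q_i\frac{\partial\gamma}{\partial p_i}\Big)\quad\text{at }(t,x,p)=(\gamma(x,p),x,p).$$ -/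

import Mathlib

open Set
open scoped ContDiff

noncomputable section

/-- The first order jet space `J¹(ℝ, ℝⁿ)` with its global coordinates `(t, x, p)`. -/
abbrev Jet (n : ℕ) : Type := ℝ × (Fin n → ℝ) × (Fin n → ℝ)

namespace Jet

variable {n : ℕ}

/-- The coordinate differential `dt`. -/
def dt : Jet n →L[ℝ] ℝ := ContinuousLinearMap.fst ℝ ℝ ((Fin n → ℝ) × (Fin n → ℝ))

/-- The coordinate differential `dxᵢ`. -/
def dx (i : Fin n) : Jet n →L[ℝ] ℝ :=
  (ContinuousLinearMap.proj (R := ℝ) (φ := fun _ : Fin n => ℝ) i).comp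
    ((ContinuousLinearMap.fst ℝ (Fin n → ℝ) (Fin n → ℝ)).comp
      (ContinuousLinearMap.snd ℝ ℝ ((Fin n → ℝ) × (Fin n → ℝ))))

/-- The coordinate differential `dpᵢ`. -/
def dp (i : Fin n) : Jet n →L[ℝ] ℝ :=
  (ContinuousLinearMap.proj (R := ℝ) (φ := fun _ : Fin n => ℝ) i).comp
    ((ContinuousLinearMap.snd ℝ (Fin n → ℝ) (Fin n → ℝ)).comp
      (ContinuousLinearMap.snd ℝ ℝ ((Fin n → ℝ) × (Fin n → ℝ))))

/-- The partial derivative `∂S/∂t` at `z`. -/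
def pderivT (S : Jet n → ℝ) (z : Jet n) : ℝ := fderiv ℝ S z (1, 0, 0)

/-- The partial derivative `∂S/∂xᵢ` at `z`. -/
def pderivX (i : Fin n) (S : Jet n → ℝ) (z : Jet n) : ℝ :=
  fderiv ℝ S z (0, Pi.single i 1, 0)

/-- The partial derivative `∂S/∂pᵢ` at `z`. -/
def pderivP (i : Fin n) (S : Jet n → ℝ) (z : Jet n) : ℝ :=
  fderiv ℝ S z (0, 0, Pi.single i 1)

/-- The coefficient `Qᵢ = ∑_{j,k} K_j (aⁱ_{jk} + aⁱ_{kj}) x_k` of `∂/∂pᵢ` in the generator;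
`a i j k` stands for `aⁱ_{jk}`. -/
def coeffP (a : Fin n → Fin n → Fin n → ℝ) (K : Fin n → Jet n → ℝ) (i : Fin n) (z : Jet n) : ℝ :=
  ∑ j, ∑ k, K j z * (a i j k + a i k j) * z.2.1 k

/-- The general contact symmetry generator
`v = T ∂/∂t + ∑ᵢ (Kᵢ ∂/∂xᵢ + Qᵢ ∂/∂pᵢ)`, as a vector field on the jet space. -/
def generator (a : Fin n → Fin n → Fin n → ℝ) (T : Jet n → ℝ) (K : Fin n → Jet n → ℝ)
    (z : Jet n) : Jet n :=
  (T z, fun i => K i z, fun i => coeffP a K i z)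

/-- The action `v[S] = T ∂S/∂t + ∑ᵢ (Kᵢ ∂S/∂xᵢ + Qᵢ ∂S/∂pᵢ)` of the generator on functions. -/
def applyGenerator (a : Fin n → Fin n → Fin n → ℝ) (T : Jet n → ℝ) (K : Fin n → Jet n → ℝ)
    (S : Jet n → ℝ) (z : Jet n) : ℝ :=
  T z * pderivT S z + ∑ i, (K i z * pderivX i S z + coeffP a K i z * pderivP i S z)

/-- `I` is a first integral on `W` of the characteristic system
`dt/T = dxᵢ/Kᵢ = dpⱼ/Qⱼ (= ds)`: it is constant along every solution curve lying in `W`. -/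
def IsFirstIntegral (a : Fin n → Fin n → Fin n → ℝ) (T : Jet n → ℝ) (K : Fin n → Jet n → ℝ)
    (W : Set (Jet n)) (I : Jet n → ℝ) : Prop :=
  ∀ (c : ℝ → Jet n) (α β : ℝ),
    IsIntegralCurveOn c (fun _ => generator a T K) (Ioo α β) → MapsTo c (Ioo α β) W →
      ∀ s ∈ Ioo α β, ∀ s' ∈ Ioo α β, I (c s) = I (c s')

/-- The functions `I α` have linearly independent differentials at each point of `W`. -/
def IsIndependent (W : Set (Jet n)) (I : Fin n ⊕ Fin n → Jet n → ℝ) : Prop :=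
  ∀ z ∈ W, LinearIndependent ℝ (fun α => fderiv ℝ (I α) z)

/-- A system of `2n` smooth independent first integrals on `W` of the characteristic system.
`I (Sum.inl i)` is the `i`-th and `I (Sum.inr i)` the `(n+i)`-th of them. -/
structure IsIntegralSystem (a : Fin n → Fin n → Fin n → ℝ) (T : Jet n → ℝ)
    (K : Fin n → Jet n → ℝ) (W : Set (Jet n)) (I : Fin n ⊕ Fin n → Jet n → ℝ) : Prop where
  smooth : ∀ α, ContDiffOn ℝ ∞ (I α) W
  firstIntegral : ∀ α, IsFirstIntegral a T K W (I α)
  independent : IsIndependent W I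

/-- The integrands `Kᵢ dt - T dxᵢ` and `Qᵢ dt - T dpᵢ` of the derived invariants, at `z`. -/
def integrand (a : Fin n → Fin n → Fin n → ℝ) (T : Jet n → ℝ) (K : Fin n → Jet n → ℝ) :
    Fin n ⊕ Fin n → Jet n → (Jet n →L[ℝ] ℝ)
  | Sum.inl i, z => K i z • dt - T z • dx i
  | Sum.inr i, z => coeffP a K i z • dt - T z • dp i

/-- The map `z ↦ (I₁(z), …, I₂ₙ(z))`. -/
def tuple (I : Fin n ⊕ Fin n → Jet n → ℝ) (z : Jet n) : Fin n ⊕ Fin n → ℝ := fun α => I α z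

end Jet

end

/-! Two facts carry the proof. Along an integral curve the derivative of S is v[S], and an integral
curve runs through every point; hence the differentiable first integrals are the solutions of v[S] =
0 (`Jet.applyGenerator_eq_zero_iff`). And 2n independent differentials on a space of dimension 2n +
1 have a line as common kernel; for first integrals it is spanned by v wherever v ≠ 0.

A complete system exists by rectification (`exists_submersion_of_ne_zero`): let a hyperplane
transversal to v flow; the coordinates of the starting point are first integrals. This needs a flow
that is smooth jointly in time and initial point, which `exists_contDiffOn_flow` obtains from the
inverse function theorem in a Banach space of curves. For S = φ(I) (`exists_nhds_factorization`),
one linear function completes I to a chart; over a box the fibres of I are arcs tangent to v, so S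
is constant on them.

Where T ≠ 0 the integrands form a basis of the covectors that kill v, so the differentials of a
complete system are an invertible combination of them. The solution t = γ(x, p) comes from the
implicit function theorem, and its equation says that v is tangent to the graph. -/

noncomputable section

open Topology Filter Metric

universe u

/-! ### Smoothness of composition operators on spaces of continuous maps -/

namespace ContinuousMap

/-- The pointwise evaluation of a continuous family of continuous linear maps, as a bounded
bilinear map. -/
def clmApplyL (X : Type*) [TopologicalSpace X] [CompactSpace X]
    (E F : Type*) [NormedAddCommGroup E] [NormedSpace ℝ E] [NormedAddCommGroup F]
    [NormedSpace ℝ F] : C(X, E →L[ℝ] F) →L[ℝ] C(X, E) →L[ℝ] C(X, F) :=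
  LinearMap.mkContinuous₂
    (LinearMap.mk₂ ℝ (fun (A : C(X, E →L[ℝ] F)) (h : C(X, E)) => (⟨fun x => A x (h x), by fun_prop⟩ : C(X, F)))
      (fun A B h => by ext x; simp) (fun c A h => by ext x; simp)
      (fun A h k => by ext x; simp) (fun c A h => by ext x; simp)) 1
    (fun (A : C(X, E →L[ℝ] F)) (h : C(X, E)) => by
      rw [one_mul]
      refine (ContinuousMap.norm_le _ (mul_nonneg (norm_nonneg A) (norm_nonneg h))).2 fun x => ?_
      exact ((A x).le_opNorm (h x)).trans
        (mul_le_mul (A.norm_coe_le_norm x) (h.norm_coe_le_norm x) (norm_nonneg _)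
          (norm_nonneg _)))

variable {X : Type*} [TopologicalSpace X] [CompactSpace X]

@[simp]
theorem clmApplyL_apply {E F : Type*} [NormedAddCommGroup E] [NormedSpace ℝ E]
    [NormedAddCommGroup F] [NormedSpace ℝ F] (A : C(X, E →L[ℝ] F)) (h : C(X, E)) (x : X) :
    clmApplyL X E F A h x = A x (h x) := rfl

/-- Composition with a `C¹` map is differentiable on spaces of continuous maps. -/
theorem hasFDerivAt_comp_left {E F : Type*} [NormedAddCommGroup E] [NormedSpace ℝ E]
    [NormedAddCommGroup F] [NormedSpace ℝ F] (f : C(E, F)) (f' : C(E, E →L[ℝ] F))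
    (hf : ∀ z, HasFDerivAt f (f' z) z) (γ : C(X, E)) :
    HasFDerivAt (fun γ : C(X, E) => f.comp γ) (clmApplyL X E F (f'.comp γ)) γ := by
  rw [hasFDerivAt_iff_isLittleO_nhds_zero, Asymptotics.isLittleO_iff]
  intro ε hε
  -- Continuity of composition with `f'` in the sup metric replaces uniform continuity of `f'`,
  -- which may fail on `E`.
  have hc : ContinuousAt (fun η : C(X, E) => f'.comp η) γ :=
    (ContinuousMap.continuous_postcomp f').continuousAt
  obtain ⟨δ, hδ, hδ'⟩ :=
    (Metric.continuousAt_iff (f := fun η : C(X, E) => f'.comp η) (a := γ)).1 hc ε hε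
  filter_upwards [Metric.ball_mem_nhds (0 : C(X, E)) hδ] with h hh
  rw [mem_ball_zero_iff] at hh
  rw [ContinuousMap.norm_le _ (by positivity)]
  intro x
  -- Each such `w` is the value at `x` of a constant translate of `γ` within `δ` of `γ`, so the
  -- sup-norm estimate applies pointwise.
  have key : ∀ w ∈ closedBall (γ x) ‖h x‖, ‖f' w - f' (γ x)‖ ≤ ε := by
    intro w hw
    rw [mem_closedBall, dist_eq_norm] at hw
    have h2 : dist (γ + ContinuousMap.const X (w - γ x)) γ < δ := by
      rw [dist_eq_norm, add_sub_cancel_left]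
      refine lt_of_le_of_lt ?_ hh
      rw [ContinuousMap.norm_le _ (norm_nonneg _)]
      intro y
      exact hw.trans (h.norm_coe_le_norm x)
    have h3 := (ContinuousMap.dist_apply_le_dist x).trans (hδ' h2).le
    simpa [dist_eq_norm] using h3
  have h4 := (convex_closedBall (γ x) ‖h x‖).norm_image_sub_le_of_norm_hasFDerivWithin_le'
    (f := f) (f' := fun w => f' w) (φ := f' (γ x)) (C := ε)
    (fun w _ => (hf w).hasFDerivWithinAt) key (x := γ x) (y := γ x + h x)
    (mem_closedBall_self (norm_nonneg _)) (by simp [dist_eq_norm])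
  have h5 : ε * ‖γ x + h x - γ x‖ ≤ ε * ‖h‖ := by
    rw [add_sub_cancel_left]
    exact mul_le_mul_of_nonneg_left (h.norm_coe_le_norm x) hε.le
  simpa using h4.trans h5

/-- The derivative of composition with `f` is composition with `f'` followed by a bounded linear
operator, which gives the induction. The target `F` changes to `E →L[ℝ] F` at each step, hence the
quantifier inside and the common universe. -/
theorem contDiff_nat_comp_left {E : Type u} [NormedAddCommGroup E] [NormedSpace ℝ E] (n : ℕ) :
    ∀ {F : Type u} [NormedAddCommGroup F] [NormedSpace ℝ F] (f : C(E, F)),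
      ContDiff ℝ n f → ContDiff ℝ n (fun γ : C(X, E) => f.comp γ) := by
  induction n with
  | zero =>
    intro F _ _ f _
    exact contDiff_zero.2 (ContinuousMap.continuous_postcomp f)
  | succ n ih =>
    intro F _ _ f hf
    obtain ⟨f', hf', hff'⟩ := contDiff_succ_iff_hasFDerivAt.1 hf
    refine contDiff_succ_iff_hasFDerivAt.2
      ⟨fun γ => clmApplyL X E F ((⟨f', hf'.continuous⟩ : C(E, E →L[ℝ] F)).comp γ), ?_,
        fun γ => hasFDerivAt_comp_left f ⟨f', hf'.continuous⟩ hff' γ⟩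
    exact (clmApplyL X E F).contDiff.comp (ih ⟨f', hf'.continuous⟩ hf')

/-- Composition with a smooth map is smooth on spaces of continuous maps. -/
theorem contDiff_comp_left {E F : Type u} [NormedAddCommGroup E] [NormedSpace ℝ E]
    [NormedAddCommGroup F] [NormedSpace ℝ F] (f : C(E, F)) (hf : ContDiff ℝ ∞ f) :
    ContDiff ℝ ∞ (fun γ : C(X, E) => f.comp γ) :=
  contDiff_infty.2 fun n => contDiff_nat_comp_left n f (contDiff_infty.1 hf n)

end ContinuousMap

/-! ### Inverse function theorem on an open set -/

/-- The inverse function theorem, with the inverse `Cʳ` on a whole open set. -/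
theorem ContDiffOn.exists_openPartialHomeomorph {E F : Type*} [NormedAddCommGroup E]
    [NormedSpace ℝ E] [CompleteSpace E] [NormedAddCommGroup F] [NormedSpace ℝ F]
    {f : E → F} {U : Set E} {r : WithTop ℕ∞} (hf : ContDiffOn ℝ r f U)
    (hU : IsOpen U) (hr : 1 ≤ r) {q : E} (hq : q ∈ U) {f' : E ≃L[ℝ] F}
    (hf' : HasFDerivAt f (f' : E →L[ℝ] F) q) :
    ∃ e : OpenPartialHomeomorph E F, (∀ z, e z = f z) ∧ q ∈ e.source ∧ e.source ⊆ U ∧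
      ContDiffOn ℝ r e.symm e.target := by
  have hr0 : r ≠ 0 := by rintro rfl; simp at hr
  have hqa := hf.contDiffAt (hU.mem_nhds hq)
  set e₀ := hqa.toOpenPartialHomeomorph f hf' hr0
  have hcont : ContinuousOn (fderiv ℝ f) U := hf.continuousOn_fderiv_of_isOpen hU hr
  -- Invertible operators form an open set; restricting to it makes the inverse regular at every
  -- point of the target, not only at the image of `q`.
  have hO : IsOpen (U ∩ fderiv ℝ f ⁻¹' range ((↑) : (E ≃L[ℝ] F) → E →L[ℝ] F)) :=
    hcont.isOpen_inter_preimage hU ContinuousLinearEquiv.isOpen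
  refine ⟨e₀.restrOpen _ hO, fun z => rfl, ⟨hqa.mem_toOpenPartialHomeomorph_source hf' hr0, hq,
    ⟨f', hf'.fderiv.symm⟩⟩, fun z hz => hz.2.1, fun y hy => ?_⟩
  obtain ⟨h1, h2⟩ := (e₀.restrOpen _ hO).map_target hy
  obtain ⟨h2, g, hg⟩ := h2
  refine ContDiffAt.contDiffWithinAt ?_
  have hc : ContDiffAt ℝ r f ((e₀.restrOpen _ hO).symm y) := hf.contDiffAt (hU.mem_nhds h2)
  refine OpenPartialHomeomorph.contDiffAt_symm (f₀' := g) _ hy ?_ hc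
  have h3 : HasFDerivAt f (fderiv ℝ f ((e₀.restrOpen _ hO).symm y)) _ :=
    (hc.differentiableAt hr0).hasFDerivAt
  rw [← hg] at h3
  exact h3

end

/-! ### Smooth local flows -/

noncomputable section

open Topology Filter Metric

universe u

/-- The compact time interval `[-1, 1]`. -/
abbrev TimeInterval : Type := Icc (-1 : ℝ) 1

namespace TimeInterval

/-- Rescaling of time. -/
instance : Mul TimeInterval := ⟨fun s t => ⟨s.1 * t.1, by
  rw [mem_Icc, ← abs_le, abs_mul]
  exact mul_le_one₀ (abs_le.2 s.2) (abs_nonneg _) (abs_le.2 t.2)⟩⟩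

theorem coe_mul (s t : TimeInterval) : ((s * t : TimeInterval) : ℝ) = s * t := rfl

section

variable {E : Type u} [NormedAddCommGroup E]

/-- Extension of a curve on `[-1, 1]` to the real line. -/
def extend (γ : C(TimeInterval, E)) (s : ℝ) : E := γ (projIcc (-1) 1 (by norm_num) s)

theorem extend_coe (γ : C(TimeInterval, E)) (s : TimeInterval) : extend γ s = γ s := by
  simp [extend]

theorem continuous_extend (γ : C(TimeInterval, E)) : Continuous (extend γ) :=
  γ.continuous.comp continuous_projIcc

/-- The curve `γ` with time rescaled by `s`. -/
def rescale (s : TimeInterval) (γ : C(TimeInterval, E)) : C(TimeInterval, E) where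
  toFun t := γ (s * t)
  continuous_toFun := γ.continuous.comp
    (Continuous.subtype_mk (continuous_const.mul continuous_subtype_val) _)

theorem rescale_apply (s t : TimeInterval) (γ : C(TimeInterval, E)) :
    rescale s γ t = γ (s * t) := rfl

theorem extend_rescale (s : TimeInterval) (γ : C(TimeInterval, E)) {σ : ℝ}
    (hσ : σ ∈ Icc (-1 : ℝ) 1) : extend (rescale s γ) σ = extend γ (s * σ) := by
  have h1 := extend_coe (rescale s γ) ⟨σ, hσ⟩
  have h2 := extend_coe γ (s * ⟨σ, hσ⟩)
  rw [rescale_apply] at h1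
  exact h1.trans h2.symm

end

variable {E : Type u} [NormedAddCommGroup E] [NormedSpace ℝ E]

/-- The primitive `s ↦ ∫₀ˢ γ` as a bounded operator. -/
def primitiveL (E : Type u) [NormedAddCommGroup E] [NormedSpace ℝ E] :
    C(TimeInterval, E) →L[ℝ] C(TimeInterval, E) :=
  LinearMap.mkContinuous
    { toFun := fun γ => ⟨fun s => ∫ σ in (0 : ℝ)..s, extend γ σ,
        (intervalIntegral.continuous_primitive
          (fun a b => (continuous_extend γ).intervalIntegrable a b) 0).comp continuous_subtype_val⟩
      map_add' := fun γ δ => by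
        ext s
        exact intervalIntegral.integral_add ((continuous_extend γ).intervalIntegrable _ _)
          ((continuous_extend δ).intervalIntegrable _ _)
      map_smul' := fun c γ => by
        ext s
        exact intervalIntegral.integral_smul c (extend γ) } 1
    (fun γ => by
      refine (ContinuousMap.norm_le _ (by positivity)).2 fun s => ?_
      refine (intervalIntegral.norm_integral_le_of_norm_le_const
        (fun σ _ => γ.norm_coe_le_norm _)).trans ?_
      rw [mul_comm, sub_zero]
      exact mul_le_mul_of_nonneg_right (abs_le.2 s.2) (norm_nonneg _))

theorem primitiveL_apply (γ : C(TimeInterval, E)) (s : TimeInterval) :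
    primitiveL E γ s = ∫ σ in (0 : ℝ)..s, extend γ σ := rfl

theorem uIcc_zero_subset (s : TimeInterval) : uIcc (0 : ℝ) s ⊆ Icc (-1) 1 :=
  uIcc_subset_Icc (by norm_num) s.2

theorem primitiveL_rescale (s t : TimeInterval) (γ : C(TimeInterval, E)) :
    (s : ℝ) • primitiveL E (rescale s γ) t = primitiveL E γ (s * t) := by
  rw [primitiveL_apply, primitiveL_apply, coe_mul]
  have h : ∫ σ in (0 : ℝ)..t, extend (rescale s γ) σ = ∫ σ in (0 : ℝ)..t, extend γ (s * σ) :=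
    intervalIntegral.integral_congr fun σ hσ => extend_rescale s γ (uIcc_zero_subset t hσ)
  rw [h, intervalIntegral.smul_integral_comp_mul_left, mul_zero]

end TimeInterval

open TimeInterval

variable {E : Type u} [NormedAddCommGroup E] [NormedSpace ℝ E]

/-- `γ` solves the integral form of `γ' = τ f(γ)`, `γ(0) = x`, with `w = (τ, x)`. -/
def IsScaledSolution (f : C(E, E)) (w : ℝ × E) (γ : C(TimeInterval, E)) : Prop :=
  γ - ContinuousMap.const _ w.2 - w.1 • primitiveL E (f.comp γ) = 0

theorem IsScaledSolution.apply {f : C(E, E)} {w : ℝ × E} {γ : C(TimeInterval, E)}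
    (h : IsScaledSolution f w γ) (s : TimeInterval) :
    γ s = w.2 + w.1 • primitiveL E (f.comp γ) s := by
  have := DFunLike.congr_fun h s
  simp only [ContinuousMap.coe_sub, ContinuousMap.coe_smul, Pi.sub_apply, Pi.smul_apply,
    ContinuousMap.const_apply, ContinuousMap.coe_zero, Pi.zero_apply] at this
  rw [sub_sub, sub_eq_zero] at this
  exact this

/-- Scaling symmetry of γ' = τ f(γ): rescaling time by `s` multiplies τ by `s`. Thus the values at
time 1, for varying τ, trace a whole trajectory. -/
theorem IsScaledSolution.rescale {f : C(E, E)} {w : ℝ × E} {γ : C(TimeInterval, E)}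
    (h : IsScaledSolution f w γ) (s : TimeInterval) :
    IsScaledSolution f (s * w.1, w.2) (rescale s γ) := by
  ext t
  have h1 := h.apply (s * t)
  have h2 := primitiveL_rescale s t (f.comp γ)
  simp only [ContinuousMap.coe_sub, ContinuousMap.coe_smul, Pi.sub_apply, Pi.smul_apply,
    ContinuousMap.const_apply, ContinuousMap.coe_zero, Pi.zero_apply]
  rw [rescale_apply, sub_sub, sub_eq_zero, h1, ← h2, smul_smul, mul_comm]
  rfl

theorem IsScaledSolution.hasDerivAt [CompleteSpace E] {f : C(E, E)} {w : ℝ × E}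
    {γ : C(TimeInterval, E)} (h : IsScaledSolution f w γ) {s : ℝ} (hs : s ∈ Ioo (-1 : ℝ) 1) :
    HasDerivAt (extend γ) (w.1 • f (extend γ s)) s := by
  have h1 : HasDerivAt (fun s => w.2 + w.1 • ∫ σ in (0 : ℝ)..s, extend (f.comp γ) σ)
      (w.1 • f (extend γ s)) s :=
    ((intervalIntegral.integral_hasDerivAt_right
      ((continuous_extend (f.comp γ)).intervalIntegrable _ _)
      ((continuous_extend (f.comp γ)).stronglyMeasurableAtFilter _ _)
      (continuous_extend (f.comp γ)).continuousAt).const_smul w.1).const_add w.2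
  refine h1.congr_of_eventuallyEq ?_
  filter_upwards [Ioo_mem_nhds hs.1 hs.2] with σ hσ
  have h2 := h.apply ⟨σ, Ioo_subset_Icc_self hσ⟩
  rw [primitiveL_apply, ← extend_coe] at h2
  exact h2

/-- A smooth vector field has a smooth local flow. -/
theorem exists_contDiffOn_flow [CompleteSpace E] {f : E → E} (hf : ContDiff ℝ ∞ f) (q : E) :
    ∃ (W : Set (ℝ × E)) (Φ : ℝ × E → E), IsOpen W ∧ ((0 : ℝ), q) ∈ W ∧ ContDiffOn ℝ ∞ Φ W ∧
      (∀ x, ((0 : ℝ), x) ∈ W → Φ (0, x) = x) ∧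
      ∀ w ∈ W, HasDerivAt (fun s => Φ (s, w.2)) (f (Φ w)) w.1 := by
  set fc : C(E, E) := ⟨f, hf.continuous⟩
  set X := C(TimeInterval, E)
  set constL : E →L[ℝ] X := ContinuousLinearMap.const ℝ TimeInterval
  -- The second component vanishes exactly on solutions; carrying the parameters along reduces the
  -- implicit function theorem to the inverse one.
  let G : (ℝ × E) × X → (ℝ × E) × X := fun z =>
    (z.1, z.2 - constL z.1.2 - z.1.1 • primitiveL E (fc.comp z.2))
  have hNem : ContDiff ℝ ∞ (fun γ : X => primitiveL E (fc.comp γ)) :=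
    (primitiveL E).contDiff.comp (ContinuousMap.contDiff_comp_left fc hf)
  have hNem2 : ContDiff ℝ ∞ (fun z : (ℝ × E) × X => primitiveL E (fc.comp z.2)) :=
    hNem.comp contDiff_snd
  have hG : ContDiff ℝ ∞ G := by
    refine contDiff_fst.prodMk ((contDiff_snd.sub (constL.contDiff.comp
      (contDiff_snd.comp contDiff_fst))).sub ((contDiff_fst.comp contDiff_fst).smul hNem2))
  set γ₀ : X := constL q
  set z₀ : (ℝ × E) × X := ((0, q), γ₀)
  let L : ℝ × E →L[ℝ] X := -(constL.comp (ContinuousLinearMap.snd ℝ ℝ E)) -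
    (ContinuousLinearMap.fst ℝ ℝ E).smulRight (primitiveL E (fc.comp γ₀))
  -- At τ = 0 the integral term has no derivative in the curve, so the derivative of `G` is
  -- triangular with identity diagonal.
  let G' : ((ℝ × E) × X) ≃L[ℝ] (ℝ × E) × X :=
    ContinuousLinearEquiv.skewProd (ContinuousLinearEquiv.refl ℝ _)
      (ContinuousLinearEquiv.refl ℝ _) L
  have hG' : HasFDerivAt G (G' : (ℝ × E) × X →L[ℝ] (ℝ × E) × X) z₀ := by
    have h1 : HasFDerivAt (fun z : (ℝ × E) × X => z.1) (ContinuousLinearMap.fst ℝ _ _) z₀ :=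
      hasFDerivAt_fst
    have h2 : HasFDerivAt (fun z : (ℝ × E) × X => z.2) (ContinuousLinearMap.snd ℝ _ _) z₀ :=
      hasFDerivAt_snd
    have h3 : HasFDerivAt (fun z : (ℝ × E) × X => z.1.1)
      ((ContinuousLinearMap.fst ℝ _ _).comp (ContinuousLinearMap.fst ℝ _ _)) z₀ := h1.fst
    have h4 : HasFDerivAt (fun z : (ℝ × E) × X => z.1.2)
      ((ContinuousLinearMap.snd ℝ _ _).comp (ContinuousLinearMap.fst ℝ _ _)) z₀ := h1.snd
    have h5 := (hNem2.differentiable (by simp) z₀).hasFDerivAt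
    have h6 := h1.prodMk ((h2.sub (constL.hasFDerivAt.comp z₀ h4)).sub (h3.smul h5))
    refine h6.congr_fderiv ?_
    refine ContinuousLinearMap.ext fun w => ?_
    simp [G', L, z₀]
    abel
  obtain ⟨e, he, hqe, -, hes⟩ :=
    hG.contDiffOn.exists_openPartialHomeomorph isOpen_univ (by simp) (mem_univ z₀) hG'
  obtain ⟨ε, hε, hεe⟩ := Metric.isOpen_iff.1 e.open_source z₀ hqe
  have hG0 : G z₀ = ((0, q), 0) := by
    simp [G, z₀, γ₀]
  have hi : Continuous (fun w : ℝ × E => (w, (0 : X))) := by fun_prop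
  -- The source of `e` need not be stable under rescaling, but a ball about `z₀` is.
  let W₀ : Set (ℝ × E) := (fun w => (w, (0 : X))) ⁻¹' (e.target ∩ e.symm ⁻¹' ball z₀ ε)
  have hW₀ : IsOpen W₀ :=
    (e.isOpen_inter_preimage_symm isOpen_ball).preimage hi
  let Γ : ℝ × E → X := fun w => (e.symm (w, 0)).2
  have hΓ : ∀ w ∈ W₀, e.symm (w, 0) = (w, Γ w) ∧ IsScaledSolution fc w (Γ w) := by
    intro w hw
    have h1 : G (e.symm (w, 0)) = (w, 0) := by rw [← he]; exact e.right_inv hw.1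
    have h2 : (e.symm (w, 0)).1 = w := congrArg Prod.fst h1
    have h3 : e.symm (w, 0) = (w, Γ w) := Prod.ext h2 rfl
    refine ⟨h3, ?_⟩
    rw [h3] at h1
    exact congrArg Prod.snd h1
  have hres : ∀ w ∈ W₀, ∀ s : TimeInterval, ((s : ℝ) * w.1, w.2) ∈ W₀ ∧
      Γ ((s : ℝ) * w.1, w.2) = rescale s (Γ w) := by
    intro w hw s
    obtain ⟨h1, h2⟩ := hΓ w hw
    have h3 := h2.rescale s
    have hb : (w, Γ w) ∈ ball z₀ ε := h1 ▸ hw.2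
    have hs1 : |(s : ℝ)| ≤ 1 := abs_le.2 s.2
    -- Rescaling shrinks |τ| and only restricts the values of the curve, while `γ₀` is constant, so
    -- the distance to `z₀` does not grow. Injectivity of `e` then identifies the rescaled curve
    -- with `Γ` at the rescaled parameter.
    have hb' : (((s : ℝ) * w.1, w.2), rescale s (Γ w)) ∈ ball z₀ ε := by
      simp only [mem_ball, Prod.dist_eq, max_lt_iff, z₀] at hb ⊢
      refine ⟨⟨?_, hb.1.2⟩, ?_⟩
      · refine lt_of_le_of_lt ?_ hb.1.1
        rw [dist_zero_right, dist_zero_right, norm_mul]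
        exact mul_le_of_le_one_left (norm_nonneg _) hs1
      · refine lt_of_le_of_lt ?_ hb.2
        exact (ContinuousMap.dist_le dist_nonneg).2 fun t =>
          ContinuousMap.dist_apply_le_dist (f := Γ w) (g := γ₀) (s * t)
    have h4 : e (((s : ℝ) * w.1, w.2), rescale s (Γ w)) = (((s : ℝ) * w.1, w.2), 0) := by
      rw [he]
      exact Prod.ext rfl h3
    have h5 := e.map_source (hεe hb')
    have h6 := e.left_inv (hεe hb')
    rw [h4] at h5 h6
    refine ⟨⟨h5, ?_⟩, ?_⟩
    · change e.symm _ ∈ ball z₀ ε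
      rw [h6]
      exact hb'
    · change (e.symm _).2 = _
      rw [h6]
  have h0W : ((0 : ℝ), q) ∈ W₀ := by
    have h1 := e.map_source hqe
    have h2 := e.left_inv hqe
    rw [he, hG0] at h1 h2
    refine ⟨h1, ?_⟩
    change e.symm _ ∈ ball z₀ ε
    rw [h2]
    exact mem_ball_self hε
  obtain ⟨τ, hτ, hτW⟩ : ∃ τ > (0 : ℝ), (τ, q) ∈ W₀ := by
    have h1 : ∀ᶠ τ : ℝ in 𝓝 0, (τ, q) ∈ W₀ :=
      (Continuous.prodMk_left q).continuousAt.eventually (hW₀.mem_nhds h0W)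
    obtain ⟨δ, hδ, h⟩ := Metric.eventually_nhds_iff.1 h1
    refine ⟨δ / 2, by positivity, h ?_⟩
    rw [dist_zero_right, Real.norm_of_nonneg (by positivity)]
    linarith
  have hmem : ∀ {s : ℝ} {x : E}, (τ, x) ∈ W₀ → |s| ≤ τ → (s, x) ∈ W₀ ∧
      Γ (s, x) ⟨1, by norm_num⟩ = extend (Γ (τ, x)) (s / τ) := by
    intro s x hx hs
    have hs' : s / τ ∈ Icc (-1 : ℝ) 1 := by
      rw [mem_Icc, ← abs_le, abs_div, abs_of_pos hτ, div_le_one hτ]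
      exact hs
    obtain ⟨h1, h2⟩ := hres _ hx ⟨s / τ, hs'⟩
    have h3 : s / τ * τ = s := div_mul_cancel₀ s hτ.ne'
    simp only [h3] at h1 h2
    refine ⟨h1, ?_⟩
    rw [h2, rescale_apply, ← extend_coe, coe_mul, mul_one]
  -- The flow is the time-1 value of `Γ`: smooth because evaluation is linear and bounded, and an
  -- integral curve in `s` because it equals the single curve `Γ (τ, x)` at time `s / τ`.
  refine ⟨{w | (τ, w.2) ∈ W₀ ∧ |w.1| < τ}, fun w => Γ w ⟨1, by norm_num⟩, ?_, ?_, ?_, ?_, ?_⟩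
  · exact (hW₀.preimage (continuous_const.prodMk continuous_snd)).inter
      (isOpen_lt (continuous_abs.comp continuous_fst) continuous_const)
  · exact ⟨hτW, by simpa using hτ⟩
  · have h1 : ContDiffOn ℝ ∞ Γ W₀ :=
      contDiff_snd.comp_contDiffOn (hes.comp (contDiff_id.prodMk contDiff_const).contDiffOn
        (fun w hw => hw.1))
    have h2 := (ContinuousMap.evalCLM ℝ (⟨1, by norm_num⟩ : TimeInterval) :
      X →L[ℝ] E).contDiff.comp_contDiffOn h1
    exact h2.mono fun w hw => (hmem hw.1 hw.2.le).1
  · intro x hx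
    have h1 := (hmem hx.1 hx.2.le).1
    have h2 := (hΓ _ h1).2.apply ⟨1, by norm_num⟩
    simpa using h2
  · rintro ⟨s, x⟩ ⟨hx, hs⟩
    have h1 := (hΓ _ hx).2.hasDerivAt (s := s / τ) (by
      rw [mem_Ioo, ← abs_lt, abs_div, abs_of_pos hτ, div_lt_one hτ]
      exact hs)
    have h2 := h1.scomp s ((hasDerivAt_id s).div_const τ)
    rw [smul_smul, one_div, inv_mul_cancel₀ hτ.ne', one_smul] at h2
    have h3 : HasDerivAt (fun s => Γ (s, x) ⟨1, by norm_num⟩) (f (extend (Γ (τ, x)) (s / τ))) s := by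
      refine h2.congr_of_eventuallyEq ?_
      have : ∀ᶠ σ : ℝ in 𝓝 s, |σ| < τ := continuous_abs.continuousAt.eventually_lt_const hs
      filter_upwards [this] with σ hσ
      exact (hmem hx hσ.le).2
    rw [← (hmem hx hs.le).2] at h3
    exact h3

end

/-! ### Independent differentials, rectification and local factorisation -/

noncomputable section

open Topology Filter Metric Module

/-- The transpose of the joint map sends coefficients to the corresponding combination of the `φ i`,
and a map is onto exactly when its transpose is injective. Independence of differentials thus
becomes the submersion property. -/
theorem linearIndependent_iff_surjective_pi {V ι : Type*} [AddCommGroup V] [Module ℝ V]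
    [TopologicalSpace V] [IsTopologicalAddGroup V] [ContinuousSMul ℝ V] [Fintype ι]
    (φ : ι → V →L[ℝ] ℝ) :
    LinearIndependent ℝ φ ↔ Function.Surjective (ContinuousLinearMap.pi φ) := by
  classical
  rw [Fintype.linearIndependent_iff]
  constructor
  · intro h
    change Function.Surjective (ContinuousLinearMap.pi φ : V →ₗ[ℝ] ι → ℝ)
    rw [← LinearMap.dualMap_injective_iff, injective_iff_map_eq_zero]
    intro ℓ hℓ
    have h1 := h (fun i => ℓ (Pi.single i 1)) (by
      ext z
      have h2 := LinearMap.congr_fun hℓ z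
      rw [LinearMap.dualMap_apply, LinearMap.pi_apply_eq_sum_univ] at h2
      have h3 : ∀ i : ι, (fun j => if i = j then (1 : ℝ) else 0) = Pi.single i 1 := fun i =>
        funext fun j => by simp only [Pi.single_apply, eq_comm]
      simp only [h3] at h2
      simpa [mul_comm] using h2)
    refine LinearMap.pi_ext' fun i => LinearMap.ext_ring ?_
    simpa using h1 i
  · intro h g hg i
    obtain ⟨z, hz⟩ := h (Pi.single i 1)
    have h1 := DFunLike.congr_fun hg z
    have h2 : ∀ j, φ j z = Pi.single (M := fun _ => ℝ) i 1 j := fun j => congrFun hz j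
    simpa [h2, Pi.single_apply] using h1

section

variable {E : Type*} [NormedAddCommGroup E] [NormedSpace ℝ E] [FiniteDimensional ℝ E]
  {ι : Type*} [Fintype ι]

/-- By rank–nullity the kernel of `A` is a line, hence spanned by `v`. -/
theorem exists_eq_smul_of_surjective (hι : Fintype.card ι + 1 = finrank ℝ E)
    {A : E →L[ℝ] ι → ℝ} (hA : Function.Surjective A) {v w : E} (hv : v ≠ 0) (hAv : A v = 0)
    (hAw : A w = 0) : ∃ c : ℝ, c • v = w := by
  have h1 := LinearMap.finrank_range_add_finrank_ker (A : E →ₗ[ℝ] ι → ℝ)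
  rw [LinearMap.range_eq_top.2 hA, finrank_top, finrank_fintype_fun_eq_card, ← hι] at h1
  have h2 : finrank ℝ (LinearMap.ker (A : E →ₗ[ℝ] ι → ℝ)) = 1 := by omega
  have h3 := (finrank_eq_one_iff_of_nonzero' (⟨v, hAv⟩ : LinearMap.ker (A : E →ₗ[ℝ] ι → ℝ))
    (fun h => hv (congrArg Subtype.val h))).1 h2 ⟨w, hAw⟩
  obtain ⟨c, hc⟩ := h3
  exact ⟨c, congrArg Subtype.val hc⟩

/-- A smooth vector field on an open set agrees near a given point with a globally smooth one. -/
theorem ContDiffOn.exists_contDiff_eqOn {F : Type*} [NormedAddCommGroup F] [NormedSpace ℝ F]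
    {v : E → F} {U : Set E} (hv : ContDiffOn ℝ ∞ v U) (hU : IsOpen U) {q : E} (hq : q ∈ U) :
    ∃ f : E → F, ContDiff ℝ ∞ f ∧ ∃ U₁ ⊆ U, IsOpen U₁ ∧ q ∈ U₁ ∧ EqOn f v U₁ := by
  obtain ⟨ε, hε, hεU⟩ := Metric.nhds_basis_closedBall.mem_iff.1 (hU.mem_nhds hq)
  let χ : ContDiffBump q := ⟨ε / 2, ε, by positivity, by linarith⟩
  refine ⟨fun z => χ z • v z, ?_, ball q (ε / 2), ?_, isOpen_ball,
    mem_ball_self (by positivity), fun z hz => ?_⟩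
  · rw [contDiff_iff_contDiffAt]
    intro z
    by_cases hz : z ∈ closedBall q ε
    · exact χ.contDiff.contDiffAt.smul (hv.contDiffAt (hU.mem_nhds (hεU hz)))
    · have h0 : (fun z => χ z • v z) =ᶠ[𝓝 z] fun _ => 0 := by
        filter_upwards [isClosed_closedBall.isOpen_compl.mem_nhds hz] with w hw
        rw [χ.zero_of_le_dist (by
          rw [mem_compl_iff, mem_closedBall, not_le] at hw
          exact hw.le), zero_smul]
      exact contDiffAt_const.congr_of_eventuallyEq h0
  · exact (ball_subset_ball (by linarith)).trans (ball_subset_closedBall.trans hεU)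
  · simp only
    rw [χ.one_of_mem_closedBall (ball_subset_closedBall hz), one_smul]

/-- Rectification: near a point where it does not vanish, a smooth vector field on an
`(m + 1)`-dimensional space has `m` smooth independent first integrals. -/
theorem exists_submersion_of_ne_zero (hι : Fintype.card ι + 1 = finrank ℝ E) {v : E → E}
    {U : Set E} (hv : ContDiffOn ℝ ∞ v U) (hU : IsOpen U) {q : E} (hq : q ∈ U) (hvq : v q ≠ 0) :
    ∃ W ⊆ U, IsOpen W ∧ q ∈ W ∧ ∃ J : E → ι → ℝ, ContDiffOn ℝ ∞ J W ∧
      ∀ z ∈ W, fderiv ℝ J z (v z) = 0 ∧ Function.Surjective (fderiv ℝ J z) := by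
  obtain ⟨f, hf, U₁, hU₁U, hU₁, hqU₁, hfv⟩ := hv.exists_contDiff_eqOn hU hq
  have : CompleteSpace E := FiniteDimensional.complete ℝ E
  obtain ⟨P, Φ, hP, hqP, hΦ, hΦ0, hΦd⟩ := exists_contDiffOn_flow hf q
  obtain ⟨ℓ, hℓ⟩ := SeparatingDual.exists_eq_one (R := ℝ) hvq
  have hker : finrank ℝ (ι → ℝ) = finrank ℝ (LinearMap.ker (ℓ : E →ₗ[ℝ] ℝ)) := by
    have h1 := Module.Dual.finrank_ker_add_one_of_ne_zero (f := (ℓ : E →ₗ[ℝ] ℝ)) (by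
      intro h
      have := LinearMap.congr_fun h (v q)
      simp [hℓ] at this)
    rw [finrank_fintype_fun_eq_card]
    omega
  let ψ : (ι → ℝ) →L[ℝ] E := (LinearMap.ker (ℓ : E →ₗ[ℝ] ℝ)).subtypeL.comp
    (ContinuousLinearEquiv.ofFinrankEq hker : (ι → ℝ) →L[ℝ] LinearMap.ker (ℓ : E →ₗ[ℝ] ℝ))
  have hℓψ : ∀ y, ℓ (ψ y) = 0 := fun y => (ContinuousLinearEquiv.ofFinrankEq hker y).2
  have hψ : Function.Injective ψ :=
    Subtype.val_injective.comp (ContinuousLinearEquiv.ofFinrankEq hker).injective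
  -- `ψ` parametrises the kernel of `ℓ`, a complement of `v q`; `F` below moves the point `q + ψ y`
  -- for time `s` along the flow.
  let i : (ι → ℝ) × ℝ → ℝ × E := fun p => (p.2, q + ψ p.1)
  have hi : ContDiff ℝ ∞ i :=
    contDiff_snd.prodMk (contDiff_const.add (ψ.contDiff.comp contDiff_fst))
  let F : (ι → ℝ) × ℝ → E := fun p => Φ (i p)
  have hO₁ : IsOpen (i ⁻¹' P) := hP.preimage hi.continuous
  have hFO₁ : ContDiffOn ℝ ∞ F (i ⁻¹' P) := hΦ.comp hi.contDiffOn (fun _ h => h)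
  have hO : IsOpen (i ⁻¹' P ∩ F ⁻¹' U₁) := hFO₁.continuousOn.isOpen_inter_preimage hO₁ hU₁
  set O := i ⁻¹' P ∩ F ⁻¹' U₁
  have hF : ContDiffOn ℝ ∞ F O := hFO₁.mono inter_subset_left
  have hi0 : i 0 = (0, q) := by simp [i]
  have hF0 : F 0 = q := by
    change Φ (i 0) = q
    rw [hi0, hΦ0 q hqP]
  have h0O : (0 : (ι → ℝ) × ℝ) ∈ O := by
    refine ⟨?_, ?_⟩
    · change i 0 ∈ P
      rw [hi0]
      exact hqP
    · change F 0 ∈ U₁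
      rw [hF0]
      exact hqU₁
  have hFd : ∀ p ∈ O, HasFDerivAt F (fderiv ℝ F p) p := fun p hp =>
    ((hF.contDiffAt (hO.mem_nhds hp)).differentiableAt (by simp)).hasFDerivAt
  have hFv : ∀ p ∈ O, fderiv ℝ F p (0, 1) = v (F p) := by
    intro p hp
    have h1 : HasDerivAt (fun s : ℝ => (p.1, s)) ((0 : ι → ℝ), (1 : ℝ)) p.2 :=
      (hasDerivAt_const p.2 p.1).prodMk (hasDerivAt_id p.2)
    have h2 := (hFd p hp).comp_hasDerivAt p.2 h1
    have h3 := hΦd (i p) hp.1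
    rw [← hfv hp.2]
    exact h2.unique h3
  have hD0 : ∀ y, fderiv ℝ F 0 (y, 0) = ψ y := by
    intro y
    have h1 : HasFDerivAt (fun y : ι → ℝ => (y, (0 : ℝ)))
        (ContinuousLinearMap.inl ℝ (ι → ℝ) ℝ) 0 := (ContinuousLinearMap.inl ℝ (ι → ℝ) ℝ).hasFDerivAt
    have h2 : HasFDerivAt (fun y : ι → ℝ => F (y, 0))
        ((fderiv ℝ F 0).comp (ContinuousLinearMap.inl ℝ (ι → ℝ) ℝ)) 0 :=
      HasFDerivAt.comp (g := F) (0 : ι → ℝ) (hFd 0 h0O) h1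
    have h3 : HasFDerivAt (fun y : ι → ℝ => F (y, 0)) ψ 0 := by
      refine (ψ.hasFDerivAt.const_add q).congr_of_eventuallyEq ?_
      have hc : ContinuousAt (fun y : ι → ℝ => i (y, 0)) 0 :=
        (hi.continuous.comp (continuous_id.prodMk continuous_const)).continuousAt
      filter_upwards [hc (hP.mem_nhds (show i 0 ∈ P from h0O.1))] with y hy
      exact hΦ0 _ hy
    have h4 := h2.unique h3
    rw [← h4]
    rfl
  have hD : ∀ p : (ι → ℝ) × ℝ, fderiv ℝ F 0 p = ψ p.1 + p.2 • v q := by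
    intro p
    have h1 : p = (p.1, 0) + p.2 • ((0 : ι → ℝ), (1 : ℝ)) := by ext <;> simp
    conv_lhs => rw [h1]
    rw [map_add, map_smul, hD0, hFv 0 h0O, hF0]
  have hinj : Function.Injective (fderiv ℝ F 0) := by
    rw [injective_iff_map_eq_zero]
    intro p hp
    rw [hD] at hp
    have h1 : p.2 = 0 := by
      have := congrArg ℓ hp
      simpa [hℓψ, hℓ] using this
    rw [h1, zero_smul, add_zero] at hp
    exact Prod.ext (hψ (hp.trans (map_zero ψ).symm)) h1
  have hdim : finrank ℝ ((ι → ℝ) × ℝ) = finrank ℝ E := by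
    rw [finrank_prod, finrank_fintype_fun_eq_card, finrank_self, hι]
  let D : ((ι → ℝ) × ℝ) ≃L[ℝ] E :=
    (LinearEquiv.ofInjectiveOfFinrankEq (fderiv ℝ F 0 : (ι → ℝ) × ℝ →ₗ[ℝ] E) hinj
      hdim).toContinuousLinearEquiv
  have hDF : HasFDerivAt F (D : (ι → ℝ) × ℝ →L[ℝ] E) 0 :=
    (hFd 0 h0O).congr_fderiv (ContinuousLinearMap.ext fun _ => rfl)
  obtain ⟨e, he, h0e, heO, hes⟩ :=
    hF.exists_openPartialHomeomorph hO (by simp) h0O hDF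
  have htar : ∀ z ∈ e.target, e.symm z ∈ O ∧ F (e.symm z) = z := fun z hz =>
    ⟨heO (e.map_target hz), by rw [← he]; exact e.right_inv hz⟩
  have hJ : ContDiffOn ℝ ∞ (fun z => (e.symm z).1) e.target := contDiff_fst.comp_contDiffOn hes
  refine ⟨e.target, fun z hz => ?_, e.open_target, ?_, fun z => (e.symm z).1, hJ, fun z hz => ?_⟩
  · have := (htar z hz).1.2
    rw [mem_preimage, (htar z hz).2] at this
    exact hU₁U this
  · have := e.map_source h0e
    rwa [he, hF0] at this
  · obtain ⟨h1, h2⟩ := htar z hz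
    have h3 : HasFDerivAt (fun z => (e.symm z).1) (fderiv ℝ (fun z => (e.symm z).1) z)
        (F (e.symm z)) := by
      rw [h2]
      exact ((hJ.contDiffAt (e.open_target.mem_nhds hz)).differentiableAt (by simp)).hasFDerivAt
    have h4 := h3.comp (e.symm z) (hFd _ h1)
    -- Differentiating `J ∘ F = Prod.fst` settles both claims: the direction `(0, 1)` maps to `v`
    -- under the derivative of `F`, and the directions `(y, 0)` give surjectivity.
    have h5 : HasFDerivAt ((fun z => (e.symm z).1) ∘ F) (ContinuousLinearMap.fst ℝ (ι → ℝ) ℝ)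
        (e.symm z) := by
      refine hasFDerivAt_fst.congr_of_eventuallyEq ?_
      filter_upwards [e.open_source.mem_nhds (e.map_target hz)] with p hp
      change (e.symm (F p)).1 = p.1
      rw [← he, e.left_inv hp]
    have h6 := h4.unique h5
    refine ⟨?_, fun y => ⟨fderiv ℝ F (e.symm z) (y, 0), DFunLike.congr_fun h6 (y, (0 : ℝ))⟩⟩
    have h7 := DFunLike.congr_fun h6 ((0 : ι → ℝ), (1 : ℝ))
    rw [ContinuousLinearMap.comp_apply, hFv _ h1, h2] at h7
    exact h7

/-- Locally, the functions annihilated by a vector field are the functions of a complete system of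
first integrals. -/
theorem exists_nhds_factorization (hι : Fintype.card ι + 1 = finrank ℝ E) {v : E → E}
    {W : Set E} (hW : IsOpen W) {J : E → ι → ℝ} (hJ : ContDiffOn ℝ ∞ J W)
    (hv : ∀ z ∈ W, v z ≠ 0) (hJv : ∀ z ∈ W, fderiv ℝ J z (v z) = 0)
    (hJs : ∀ z ∈ W, Function.Surjective (fderiv ℝ J z)) {q : E} (hq : q ∈ W) :
    ∃ N ⊆ W, IsOpen N ∧ q ∈ N ∧ IsOpen (J '' N) ∧ ∀ (r : ℕ∞), 1 ≤ r → ∀ S : E → ℝ,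
      (ContDiffOn ℝ r S N ∧ ∀ z ∈ N, fderiv ℝ S z (v z) = 0) ↔
        ∃ φ : (ι → ℝ) → ℝ, ContDiffOn ℝ r φ (J '' N) ∧ ∀ z ∈ N, S z = φ (J z) := by
  have : CompleteSpace E := FiniteDimensional.complete ℝ E
  obtain ⟨ℓ, hℓ⟩ := SeparatingDual.exists_eq_one (R := ℝ) (hv q hq)
  let F : E → (ι → ℝ) × ℝ := fun z => (J z, ℓ z)
  have hF : ContDiffOn ℝ ∞ F W := hJ.prodMk ℓ.contDiff.contDiffOn
  have hJd : ∀ z ∈ W, HasFDerivAt J (fderiv ℝ J z) z := fun z hz =>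
    ((hJ.contDiffAt (hW.mem_nhds hz)).differentiableAt (by simp)).hasFDerivAt
  have hFd : ∀ z ∈ W, HasFDerivAt F ((fderiv ℝ J z).prod ℓ) z := fun z hz =>
    (hJd z hz).prodMk ℓ.hasFDerivAt
  have hinj : Function.Injective ((fderiv ℝ J q).prod ℓ) := by
    rw [injective_iff_map_eq_zero]
    intro w hw
    obtain ⟨c, rfl⟩ := exists_eq_smul_of_surjective hι (hJs q hq) (hv q hq) (hJv q hq)
      (congrArg Prod.fst hw)
    have h1 : ℓ (c • v q) = 0 := congrArg Prod.snd hw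
    rw [map_smul, hℓ, smul_eq_mul, mul_one] at h1
    rw [h1, zero_smul]
  have hdim : finrank ℝ E = finrank ℝ ((ι → ℝ) × ℝ) := by
    rw [finrank_prod, finrank_fintype_fun_eq_card, finrank_self, hι]
  let D : E ≃L[ℝ] ((ι → ℝ) × ℝ) :=
    (LinearEquiv.ofInjectiveOfFinrankEq
      ((fderiv ℝ J q).prod ℓ : E →ₗ[ℝ] (ι → ℝ) × ℝ) hinj hdim).toContinuousLinearEquiv
  have hDF : HasFDerivAt F (D : E →L[ℝ] (ι → ℝ) × ℝ) q :=
    (hFd q hq).congr_fderiv (ContinuousLinearMap.ext fun _ => rfl)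
  obtain ⟨e, he, hqe, heW, hes⟩ := hF.exists_openPartialHomeomorph hW (by simp) hq hDF
  have hqt : F q ∈ e.target := by
    rw [← he]
    exact e.map_source hqe
  obtain ⟨ε, hε, hεt⟩ := Metric.isOpen_iff.1 e.open_target (F q) hqt
  have hball : ball (F q) ε = ball (J q) ε ×ˢ ball (ℓ q) ε := (ball_prod_same _ _ _).symm
  -- In the max metric this ball is a box, so each fibre of `J` in `N` is a full interval in the
  -- coordinate `ℓ`. Neither `r` nor `S` enters the choice.
  let N : Set E := e.source ∩ e ⁻¹' ball (F q) ε
  have hN : IsOpen N := e.isOpen_inter_preimage isOpen_ball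
  have hNW : N ⊆ W := fun z hz => heW hz.1
  have hNF : ∀ z ∈ N, J z ∈ ball (J q) ε ∧ ℓ z ∈ ball (ℓ q) ε := by
    intro z hz
    have h1 := hz.2
    rw [mem_preimage, he, hball] at h1
    exact h1
  have hsymm : ∀ y ∈ ball (J q) ε, ∀ s ∈ ball (ℓ q) ε, (y, s) ∈ e.target ∧ e.symm (y, s) ∈ N ∧
      F (e.symm (y, s)) = (y, s) := by
    intro y hy s hs
    have h1 : (y, s) ∈ ball (F q) ε := by
      rw [hball]
      exact ⟨hy, hs⟩
    have h2 := e.right_inv (hεt h1)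
    refine ⟨hεt h1, ⟨e.map_target (hεt h1), ?_⟩, by rw [← he, h2]⟩
    rw [mem_preimage, h2]
    exact h1
  have hJN : J '' N = ball (J q) ε := by
    refine Subset.antisymm (image_subset_iff.2 fun z hz => (hNF z hz).1) fun y hy => ?_
    obtain ⟨-, h1, h2⟩ := hsymm y hy (ℓ q) (mem_ball_self hε)
    exact ⟨_, h1, congrArg Prod.fst h2⟩
  refine ⟨N, hNW, hN, ⟨hqe, ?_⟩, hJN ▸ isOpen_ball, fun r hr S => ⟨?_, ?_⟩⟩
  · rw [mem_preimage, he]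
    exact mem_ball_self hε
  · rintro ⟨hS, hSv⟩
    have hr0 : (r : WithTop ℕ∞) ≠ 0 := by
      have : r ≠ 0 := by rintro rfl; simp at hr
      exact_mod_cast this
    -- `φ` is `S` restricted to the slice on which `ℓ` has the value `ℓ q`.
    refine ⟨fun y => S (e.symm (y, ℓ q)), ?_, fun z hz => ?_⟩
    · rw [hJN]
      refine hS.comp ((hes.of_le (by exact_mod_cast le_top)).comp
        (contDiff_id.prodMk contDiff_const).contDiffOn fun y hy => ?_) fun y hy => ?_
      · exact (hsymm y hy _ (mem_ball_self hε)).1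
      · exact (hsymm y hy _ (mem_ball_self hε)).2.1
    · obtain ⟨hz1, hz2⟩ := hNF z hz
      have hd : ∀ s ∈ ball (ℓ q) ε, HasDerivAt (fun s => S (e.symm (J z, s))) 0 s := by
        intro s hs
        obtain ⟨h1, h2, h3⟩ := hsymm _ hz1 s hs
        have h4 : HasFDerivAt e.symm (fderiv ℝ e.symm (J z, s)) (J z, s) :=
          ((hes.contDiffAt (e.open_target.mem_nhds h1)).differentiableAt (by simp)).hasFDerivAt
        have h5 : HasDerivAt (fun s : ℝ => (J z, s)) ((0 : ι → ℝ), (1 : ℝ)) s :=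
          (hasDerivAt_const s (J z)).prodMk (hasDerivAt_id s)
        have h6 := h4.comp_hasDerivAt s h5
        set w := fderiv ℝ e.symm (J z, s) (0, 1)
        -- The tangent of a fibre is killed by the derivative of `J`, so it is a multiple of `v`,
        -- along which `S` has zero derivative.
        have h7 : fderiv ℝ J (e.symm (J z, s)) w = 0 := by
          have h8 := (hJd _ (hNW h2)).comp_hasDerivAt s h6
          have h9 : HasDerivAt (J ∘ (e.symm ∘ fun s : ℝ => (J z, s))) 0 s := by
            refine (hasDerivAt_const s (J z)).congr_of_eventuallyEq ?_
            filter_upwards [isOpen_ball.mem_nhds hs] with σ hσ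
            exact congrArg Prod.fst (hsymm _ hz1 σ hσ).2.2
          exact h8.unique h9
        obtain ⟨c, hc⟩ := exists_eq_smul_of_surjective hι (hJs _ (hNW h2)) (hv _ (hNW h2))
          (hJv _ (hNW h2)) h7
        have h10 : HasFDerivAt S (fderiv ℝ S (e.symm (J z, s))) (e.symm (J z, s)) :=
          ((hS.contDiffAt (hN.mem_nhds h2)).differentiableAt hr0).hasFDerivAt
        have h11 := h10.comp_hasDerivAt s h6
        rw [← hc, map_smul, hSv _ h2, smul_zero] at h11
        exact h11
      have hconst := isOpen_ball.is_const_of_deriv_eq_zero (convex_ball (ℓ q) ε).isPreconnected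
        (fun s hs => (hd s hs).differentiableAt.differentiableWithinAt)
        (fun s hs => (hd s hs).deriv) hz2 (mem_ball_self hε)
      have hzz : e.symm (J z, ℓ z) = z := by
        have := e.left_inv hz.1
        rwa [he] at this
      simp only [hzz] at hconst
      exact hconst
  · rintro ⟨φ, hφ, hSφ⟩
    have hr0 : (r : WithTop ℕ∞) ≠ 0 := by
      have : r ≠ 0 := by rintro rfl; simp at hr
      exact_mod_cast this
    refine ⟨(hφ.comp ((hJ.mono hNW).of_le (by exact_mod_cast le_top))
      (fun z hz => mem_image_of_mem J hz)).congr hSφ, fun z hz => ?_⟩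
    have hφd : HasFDerivAt φ (fderiv ℝ φ (J z)) (J z) :=
      ((hφ.contDiffAt ((hJN ▸ isOpen_ball : IsOpen (J '' N)).mem_nhds
        (mem_image_of_mem J hz))).differentiableAt hr0).hasFDerivAt
    have h1 : HasFDerivAt S ((fderiv ℝ φ (J z)).comp (fderiv ℝ J z)) z := by
      refine (hφd.comp z (hJd z (hNW hz))).congr_of_eventuallyEq ?_
      filter_upwards [hN.mem_nhds hz] with w hw using hSφ w hw
    rw [h1.fderiv, ContinuousLinearMap.comp_apply, hJv z (hNW hz), map_zero]

/-! ### Implicit function theorem -/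

/-- The implicit function theorem for one scalar equation solved for the first variable. -/
theorem ContDiffOn.exists_implicit_fst {S : ℝ × E → ℝ} {N : Set (ℝ × E)} {r : ℕ∞} (hr : 1 ≤ r)
    (hS : ContDiffOn ℝ r S N) (hN : IsOpen N) {q : ℝ × E} (hq : q ∈ N) (hSq : S q = 0)
    (hdS : fderiv ℝ S q (1, 0) ≠ 0) :
    ∃ (A : Set ℝ) (B : Set E) (g : E → ℝ), IsOpen A ∧ IsOpen B ∧ q ∈ A ×ˢ B ∧ A ×ˢ B ⊆ N ∧
      ContDiffOn ℝ r g B ∧ MapsTo g B A ∧ (∀ t ∈ A, ∀ w ∈ B, S (t, w) = 0 ↔ t = g w) ∧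
      ∀ w ∈ B, fderiv ℝ S (g w, w) (1, 0) ≠ 0 ∧
        ∀ h, fderiv ℝ S (g w, w) (fderiv ℝ g w h, h) = 0 := by
  have : CompleteSpace E := FiniteDimensional.complete ℝ E
  have hr1 : (1 : WithTop ℕ∞) ≤ r := by exact_mod_cast hr
  have hr0 : (r : WithTop ℕ∞) ≠ 0 := by
    have : r ≠ 0 := by rintro rfl; simp at hr
    exact_mod_cast this
  have hN₁ : IsOpen (N ∩ (fun z => fderiv ℝ S z (1, 0)) ⁻¹' {0}ᶜ) :=
    ((hS.continuousOn_fderiv_of_isOpen hN hr1).clm_apply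
      continuousOn_const).isOpen_inter_preimage hN isOpen_compl_singleton
  set N₁ := N ∩ (fun z => fderiv ℝ S z (1, 0)) ⁻¹' {0}ᶜ
  have hSd : ∀ z ∈ N, HasFDerivAt S (fderiv ℝ S z) z := fun z hz =>
    ((hS.contDiffAt (hN.mem_nhds hz)).differentiableAt hr0).hasFDerivAt
  let F : ℝ × E → ℝ × E := fun z => (S z, z.2)
  have hF : ContDiffOn ℝ r F N₁ := (hS.mono inter_subset_left).prodMk contDiff_snd.contDiffOn
  have hFd : HasFDerivAt F ((fderiv ℝ S q).prod (ContinuousLinearMap.snd ℝ ℝ E)) q :=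
    (hSd q hq).prodMk hasFDerivAt_snd
  have hinj : Function.Injective ((fderiv ℝ S q).prod (ContinuousLinearMap.snd ℝ ℝ E)) := by
    rw [injective_iff_map_eq_zero]
    rintro ⟨t, w⟩ h
    have h1 : w = 0 := congrArg Prod.snd h
    subst h1
    have h2 : fderiv ℝ S q (t, 0) = 0 := congrArg Prod.fst h
    have h3 : ((t, 0) : ℝ × E) = t • (1, 0) := by simp
    rw [h3, map_smul, smul_eq_mul, mul_eq_zero] at h2
    rw [h2.resolve_right hdS]
    rfl
  let D : (ℝ × E) ≃L[ℝ] ℝ × E :=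
    (LinearEquiv.ofInjectiveOfFinrankEq
      ((fderiv ℝ S q).prod (ContinuousLinearMap.snd ℝ ℝ E) : ℝ × E →ₗ[ℝ] ℝ × E) hinj
        rfl).toContinuousLinearEquiv
  have hDF : HasFDerivAt F (D : ℝ × E →L[ℝ] ℝ × E) q :=
    hFd.congr_fderiv (ContinuousLinearMap.ext fun _ => rfl)
  obtain ⟨e, he, hqe, heN, hes⟩ := hF.exists_openPartialHomeomorph hN₁ hr1 ⟨hq, hdS⟩ hDF
  obtain ⟨A, B₀, hA, hB₀, hqA, hqB₀, hAB₀⟩ :=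
    isOpen_prod_iff.1 e.open_source q.1 q.2 hqe
  let i : E → ℝ × E := fun w => (0, w)
  have hi : ContDiff ℝ r i := contDiff_const.prodMk contDiff_id
  let g : E → ℝ := fun w => (e.symm (i w)).1
  have hg₁ : ContDiffOn ℝ r g (i ⁻¹' e.target) :=
    contDiff_fst.comp_contDiffOn (hes.comp hi.contDiffOn fun _ h => h)
  have hB₁ : IsOpen (i ⁻¹' e.target ∩ g ⁻¹' A) :=
    hg₁.continuousOn.isOpen_inter_preimage (e.open_target.preimage hi.continuous) hA
  -- `B₀` keeps the box inside the source of `e`, where injectivity gives uniqueness of the root;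
  -- the preimage of `A` keeps the graph inside the box.
  let B : Set E := B₀ ∩ (i ⁻¹' e.target ∩ g ⁻¹' A)
  have hB : IsOpen B := hB₀.inter hB₁
  have hg : ContDiffOn ℝ r g B := hg₁.mono fun w hw => hw.2.1
  have hFq : e q = i q.2 := by
    rw [he]
    exact Prod.ext hSq rfl
  have hqB : q.2 ∈ B := by
    have h1 := e.map_source hqe
    have h2 := e.left_inv hqe
    rw [hFq] at h1 h2
    refine ⟨hqB₀, h1, ?_⟩
    change (e.symm (i q.2)).1 ∈ A
    rw [h2]
    exact hqA
  have hABN : A ×ˢ B ⊆ N₁ := fun z hz => heN (hAB₀ ⟨hz.1, hz.2.1⟩)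
  have hgA : MapsTo g B A := fun w hw => hw.2.2
  have hgS : ∀ w ∈ B, S (g w, w) = 0 := by
    intro w hw
    have h1 : F (e.symm (i w)) = i w := by
      rw [← he]
      exact e.right_inv hw.2.1
    have h3 : (e.symm (i w)).2 = w := congrArg Prod.snd h1
    have h2 : e.symm (i w) = (g w, w) := Prod.ext rfl h3
    rw [h2] at h1
    exact congrArg Prod.fst h1
  refine ⟨A, B, g, hA, hB, ⟨hqA, hqB⟩, hABN.trans inter_subset_left, hg, hgA, ?_, ?_⟩
  · intro t ht w hw
    refine ⟨fun h => ?_, fun h => h ▸ hgS w hw⟩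
    have h1 := e.left_inv (hAB₀ (mk_mem_prod ht hw.1))
    have h2 : e (t, w) = i w := by
      rw [he]
      exact Prod.ext h rfl
    rw [h2] at h1
    exact (congrArg Prod.fst h1).symm
  · intro w hw
    have hgw : (g w, w) ∈ N₁ := hABN ⟨hgA hw, hw⟩
    refine ⟨hgw.2, fun h => ?_⟩
    have hgd : HasFDerivAt g (fderiv ℝ g w) w :=
      ((hg.contDiffAt (hB.mem_nhds hw)).differentiableAt hr0).hasFDerivAt
    have h1 : HasFDerivAt (fun w => S (g w, w))
        ((fderiv ℝ S (g w, w)).comp ((fderiv ℝ g w).prod (ContinuousLinearMap.id ℝ E))) w :=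
      HasFDerivAt.comp (g := S) w (hSd _ hgw.1) (hgd.prodMk (hasFDerivAt_id w))
    have h2 : HasFDerivAt (fun w => S (g w, w)) (0 : E →L[ℝ] ℝ) w := by
      refine (hasFDerivAt_const 0 w).congr_of_eventuallyEq ?_
      filter_upwards [hB.mem_nhds hw] with w' hw' using hgS w' hw'
    exact DFunLike.congr_fun (h1.unique h2) h

end

end

/-! ### First integrals on the jet space -/

noncomputable section

open Topology Filter Metric Module

namespace Jet

variable {n : ℕ} {a : Fin n → Fin n → Fin n → ℝ} {T : Jet n → ℝ} {K : Fin n → Jet n → ℝ}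
  {U W : Set (Jet n)}

theorem clm_apply (L : Jet n →L[ℝ] ℝ) (w : Jet n) :
    L w = w.1 * L (1, 0, 0) + ∑ i, (w.2.1 i * L (0, Pi.single i 1, 0) +
      w.2.2 i * L (0, 0, Pi.single i 1)) := by
  have h : w = w.1 • (1, 0, 0) + ∑ i, (w.2.1 i • (0, Pi.single i 1, 0) +
      w.2.2 i • (0, 0, Pi.single i 1)) := by
    refine Prod.ext ?_ (Prod.ext ?_ ?_)
    · simp [Prod.fst_sum]
    · ext j
      simp [Prod.fst_sum, Prod.snd_sum, Finset.sum_apply, Pi.single_apply]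
    · ext j
      simp [Prod.snd_sum, Finset.sum_apply, Pi.single_apply]
  conv_lhs => rw [h]
  simp only [map_add, map_sum, map_smul, smul_eq_mul]

theorem applyGenerator_eq (S : Jet n → ℝ) (z : Jet n) :
    applyGenerator a T K S z = fderiv ℝ S z (generator a T K z) :=
  (clm_apply (fderiv ℝ S z) (generator a T K z)).symm

theorem contDiffOn_coeffP (hK : ∀ i, ContDiffOn ℝ ∞ (K i) U) (i : Fin n) :
    ContDiffOn ℝ ∞ (coeffP a K i) U := by
  refine ContDiffOn.sum fun j _ => ContDiffOn.sum fun k _ => ?_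
  have h : ContDiff ℝ ∞ (fun z : Jet n => z.2.1 k) := by fun_prop
  exact ((hK j).mul contDiffOn_const).mul h.contDiffOn

theorem contDiffOn_generator (hT : ContDiffOn ℝ ∞ T U) (hK : ∀ i, ContDiffOn ℝ ∞ (K i) U) :
    ContDiffOn ℝ ∞ (generator a T K) U :=
  hT.prodMk ((contDiffOn_pi.2 hK).prodMk (contDiffOn_pi.2 (contDiffOn_coeffP hK)))

theorem card_add_one_eq_finrank :
    Fintype.card (Fin n ⊕ Fin n) + 1 = finrank ℝ (Jet n) := by
  simp
  omega

/-- The chain rule gives one direction; for the other, Picard–Lindelöf supplies an integral curve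
through each point, along which the constant `S` is differentiated at time 0. -/
theorem applyGenerator_eq_zero_iff (hU : IsOpen U) (hT : ContDiffOn ℝ ∞ T U)
    (hK : ∀ i, ContDiffOn ℝ ∞ (K i) U) {N : Set (Jet n)} (hNU : N ⊆ U) (hN : IsOpen N)
    {S : Jet n → ℝ} (hS : DifferentiableOn ℝ S N) :
    (∀ z ∈ N, applyGenerator a T K S z = 0) ↔ IsFirstIntegral a T K N S := by
  have hSd : ∀ z ∈ N, HasFDerivAt S (fderiv ℝ S z) z := fun z hz =>
    (hS.differentiableAt (hN.mem_nhds hz)).hasFDerivAt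
  simp only [applyGenerator_eq]
  constructor
  · intro h c α β hc hcN s hs s' hs'
    have hd : ∀ s ∈ Ioo α β, HasDerivAt (fun s => S (c s)) 0 s := by
      intro s hs
      have h1 := (hc s hs).hasDerivAt (Ioo_mem_nhds hs.1 hs.2)
      have h2 := (hSd _ (hcN hs)).comp_hasDerivAt s h1
      rw [h _ (hcN hs)] at h2
      exact h2
    exact isOpen_Ioo.is_const_of_deriv_eq_zero isPreconnected_Ioo
      (fun s hs => (hd s hs).differentiableAt.differentiableWithinAt)
      (fun s hs => (hd s hs).deriv) hs hs'
  · intro h z hz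
    have hv : ContDiffAt ℝ 1 (generator a T K) z :=
      ((contDiffOn_generator hT hK).contDiffAt (hU.mem_nhds (hNU hz))).of_le (by simp)
    obtain ⟨c, hc0, ε, hε, hc⟩ :=
      hv.exists_forall_mem_closedBall_exists_eq_forall_mem_Ioo_hasDerivAt₀ 0
    simp only [zero_sub, zero_add] at hc
    have hcN : ∀ᶠ s in 𝓝 (0 : ℝ), c s ∈ N :=
      (hc 0 ⟨by linarith, hε⟩).continuousAt.eventually (by rw [hc0]; exact hN.mem_nhds hz)
    obtain ⟨δ, hδ, hδN⟩ := Metric.eventually_nhds_iff.1 hcN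
    have hm : (0 : ℝ) < min ε δ := lt_min hε hδ
    have hconst := h c (-min ε δ) (min ε δ)
      (fun s hs => (hc s ⟨lt_of_le_of_lt (neg_le_neg (min_le_left _ _)) hs.1,
        hs.2.trans_le (min_le_left _ _)⟩).hasDerivWithinAt)
      (fun s hs => hδN (by
        rw [dist_zero_right, Real.norm_eq_abs]
        exact (abs_lt.2 hs).trans_le (min_le_right _ _)))
    have h0 : (0 : ℝ) ∈ Ioo (-min ε δ) (min ε δ) := ⟨by linarith, hm⟩
    have h1 : HasDerivAt (fun s => S (c s)) (fderiv ℝ S (c 0) (generator a T K (c 0))) 0 := by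
      refine (hSd (c 0) ?_).comp_hasDerivAt 0 (hc 0 ⟨by linarith, hε⟩)
      rw [hc0]
      exact hz
    have h2 : HasDerivAt (fun s => S (c s)) 0 0 := by
      refine (hasDerivAt_const (0 : ℝ) (S (c 0))).congr_of_eventuallyEq ?_
      filter_upwards [Ioo_mem_nhds h0.1 h0.2] with s hs
      exact hconst s hs 0 h0
    rw [hc0] at h1
    exact h1.unique h2

theorem hasFDerivAt_tuple {I : Fin n ⊕ Fin n → Jet n → ℝ} (hW : IsOpen W)
    (hI : ∀ α, ContDiffOn ℝ ∞ (I α) W) {z : Jet n} (hz : z ∈ W) :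
    HasFDerivAt (tuple I) (ContinuousLinearMap.pi fun α => fderiv ℝ (I α) z) z :=
  hasFDerivAt_pi.2 fun α =>
    (((hI α).contDiffAt (hW.mem_nhds hz)).differentiableAt (by simp)).hasFDerivAt

theorem exists_isIntegralSystem (hU : IsOpen U) (hT : ContDiffOn ℝ ∞ T U)
    (hK : ∀ i, ContDiffOn ℝ ∞ (K i) U) {q : Jet n} (hq : q ∈ U) (hvq : generator a T K q ≠ 0) :
    ∃ W ⊆ U, IsOpen W ∧ q ∈ W ∧ ∃ I, IsIntegralSystem a T K W I := by
  obtain ⟨W, hWU, hW, hqW, J, hJ, hJv⟩ :=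
    exists_submersion_of_ne_zero card_add_one_eq_finrank (contDiffOn_generator hT hK) hU hq hvq
  have hI : ∀ α, ContDiffOn ℝ ∞ (fun z => J z α) W := contDiffOn_pi.1 hJ
  have hd : ∀ z ∈ W, fderiv ℝ J z =
      ContinuousLinearMap.pi fun α => fderiv ℝ (fun z => J z α) z := fun z hz =>
    (hasFDerivAt_tuple hW hI hz).fderiv
  refine ⟨W, hWU, hW, hqW, fun α z => J z α, hI, fun α => ?_, fun z hz => ?_⟩
  · rw [← applyGenerator_eq_zero_iff hU hT hK hWU hW ((hI α).differentiableOn (by simp))]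
    intro z hz
    have h := (hJv z hz).1
    rw [hd z hz] at h
    rw [applyGenerator_eq]
    exact congrFun h α
  · rw [linearIndependent_iff_surjective_pi, ← hd z hz]
    exact (hJv z hz).2

theorem integrand_generator (α : Fin n ⊕ Fin n) (z : Jet n) :
    integrand a T K α z (generator a T K z) = 0 := by
  rcases α with i | i <;> simp [integrand, generator, dt, dx, dp, mul_comm]

theorem linearIndependent_integrand {z : Jet n} (hz : T z ≠ 0) :
    LinearIndependent ℝ fun α => integrand a T K α z := by
  rw [Fintype.linearIndependent_iff]
  intro c hc
  rw [Sum.forall]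
  constructor
  · intro i
    have h := DFunLike.congr_fun hc ((0, Pi.single i 1, 0) : Jet n)
    simp [integrand, dt, dx, dp, Pi.single_apply] at h
    exact h.resolve_right hz
  · intro i
    have h := DFunLike.congr_fun hc ((0, 0, Pi.single i 1) : Jet n)
    simp [integrand, dt, dx, dp, Pi.single_apply] at h
    exact h.resolve_right hz

theorem contDiffOn_integrand (hT : ContDiffOn ℝ ∞ T U) (hK : ∀ i, ContDiffOn ℝ ∞ (K i) U)
    (α : Fin n ⊕ Fin n) : ContDiffOn ℝ ∞ (integrand a T K α) U := by
  rcases α with i | i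
  · exact ((hK i).smul contDiffOn_const).sub (hT.smul contDiffOn_const)
  · exact ((contDiffOn_coeffP hK i).smul contDiffOn_const).sub (hT.smul contDiffOn_const)

/-- A linear form annihilating the generator is a combination of the integrands. -/
theorem eq_sum_smul_integrand {z : Jet n} (hz : T z ≠ 0) {L : Jet n →L[ℝ] ℝ}
    (hL : L (generator a T K z) = 0) :
    L = ∑ β, Sum.elim (fun i => -L (0, Pi.single i 1, 0) / T z)
      (fun i => -L (0, 0, Pi.single i 1) / T z) β • integrand a T K β z := by
  refine ContinuousLinearMap.ext fun w => ?_
  rw [clm_apply] at hL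
  rw [clm_apply L w]
  -- The coefficients match the `dx` and `dp` parts of `L`; its `dt` part is then forced by `hL`, as
  -- T ≠ 0.
  have h1 : L (1, 0, 0) = -(∑ i, ((generator a T K z).2.1 i * L (0, Pi.single i 1, 0) +
      (generator a T K z).2.2 i * L (0, 0, Pi.single i 1))) / T z := by
    rw [eq_div_iff hz]
    simp only [generator] at hL ⊢
    linarith
  rw [h1]
  simp only [Fintype.sum_sum_type, Sum.elim_inl, Sum.elim_inr, integrand,
    add_apply, sum_apply, smul_apply,
    sub_apply, smul_eq_mul, dt, dx, dp, ContinuousLinearMap.comp_apply,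
    ContinuousLinearMap.coe_fst', ContinuousLinearMap.coe_snd', ContinuousLinearMap.proj_apply,
    generator]
  rw [← Finset.sum_add_distrib, ← Finset.sum_neg_distrib, Finset.sum_div, Finset.mul_sum,
    ← Finset.sum_add_distrib]
  refine Finset.sum_congr rfl fun i _ => ?_
  field_simp
  ring

/-- Combining the `θ β` is injective on coefficient vectors, so independence of the family is
independence of the rows of `M`. -/
theorem linearIndependent_sum_smul_iff {V ι : Type*} [AddCommGroup V] [Module ℝ V] [Fintype ι]
    [DecidableEq ι] {θ : ι → V} (hθ : LinearIndependent ℝ θ) (M : Matrix ι ι ℝ) :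
    LinearIndependent ℝ (fun α => ∑ β, M α β • θ β) ↔ IsUnit M.det := by
  rw [← Matrix.isUnit_iff_isUnit_det, ← Matrix.linearIndependent_rows_iff_isUnit]
  exact (Fintype.linearCombination ℝ θ).linearIndependent_iff
    (LinearMap.ker_eq_bot.2 hθ.fintypeLinearCombination_injective) (v := M.row)

theorem isIntegralSystem_of_fderiv_eq (hU : IsOpen U) (hT : ContDiffOn ℝ ∞ T U)
    (hK : ∀ i, ContDiffOn ℝ ∞ (K i) U) (hWU : W ⊆ U) (hW : IsOpen W)
    {I : Fin n ⊕ Fin n → Jet n → ℝ} (hI : ∀ α, ContDiffOn ℝ ∞ (I α) W)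
    {M : Jet n → Matrix (Fin n ⊕ Fin n) (Fin n ⊕ Fin n) ℝ} (hT0 : ∀ z ∈ W, T z ≠ 0)
    (hM : ∀ z ∈ W, IsUnit (M z).det ∧
      ∀ α, fderiv ℝ (I α) z = ∑ β, M z α β • integrand a T K β z) :
    IsIntegralSystem a T K W I := by
  refine ⟨hI, fun α => ?_, fun z hz => ?_⟩
  · rw [← applyGenerator_eq_zero_iff hU hT hK hWU hW ((hI α).differentiableOn (by simp))]
    intro z hz
    rw [applyGenerator_eq, (hM z hz).2 α]
    simp [integrand_generator]
  · have h := (linearIndependent_sum_smul_iff (linearIndependent_integrand (a := a) (K := K)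
      (hT0 z hz)) (M z)).2 (hM z hz).1
    simpa only [← (hM z hz).2] using h

/-- The entries of `M` are partial derivatives of the integrals divided by −T, so they are smooth;
independence makes `M` invertible. -/
theorem IsIntegralSystem.exists_matrix (hU : IsOpen U) (hT : ContDiffOn ℝ ∞ T U)
    (hK : ∀ i, ContDiffOn ℝ ∞ (K i) U) (hWU : W ⊆ U) (hW : IsOpen W) (hT0 : ∀ z ∈ W, T z ≠ 0)
    {I : Fin n ⊕ Fin n → Jet n → ℝ} (hI : IsIntegralSystem a T K W I) :
    ∃ M : Jet n → Matrix (Fin n ⊕ Fin n) (Fin n ⊕ Fin n) ℝ,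
      (∀ α β, ContDiffOn ℝ ∞ (fun z => M z α β) W) ∧
      ∀ z ∈ W, IsUnit (M z).det ∧
        ∀ α, fderiv ℝ (I α) z = ∑ β, M z α β • integrand a T K β z := by
  let M : Jet n → Matrix (Fin n ⊕ Fin n) (Fin n ⊕ Fin n) ℝ := fun z α =>
    Sum.elim (fun i => -fderiv ℝ (I α) z (0, Pi.single i 1, 0) / T z)
      (fun i => -fderiv ℝ (I α) z (0, 0, Pi.single i 1) / T z)
  have hM : ∀ z ∈ W, ∀ α, fderiv ℝ (I α) z = ∑ β, M z α β • integrand a T K β z := by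
    intro z hz α
    refine eq_sum_smul_integrand (hT0 z hz) ?_
    rw [← applyGenerator_eq]
    exact (applyGenerator_eq_zero_iff hU hT hK hWU hW
      ((hI.smooth α).differentiableOn (by simp))).2 (hI.firstIntegral α) z hz
  refine ⟨M, fun α β => ?_, fun z hz => ⟨?_, hM z hz⟩⟩
  · have hd : ContDiffOn ℝ ∞ (fderiv ℝ (I α)) W :=
      (hI.smooth α).fderiv_of_isOpen hW (by simp)
    rcases β with i | i
    · exact (hd.clm_apply contDiffOn_const).neg.div (hT.mono hWU) hT0
    · exact (hd.clm_apply contDiffOn_const).neg.div (hT.mono hWU) hT0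
  · rw [← linearIndependent_sum_smul_iff (linearIndependent_integrand (a := a) (K := K)
      (hT0 z hz)) (M z)]
    simpa only [← hM z hz] using hI.independent z hz

/-- Differentiability suffices as input: the derivative is itself a smooth form. -/
theorem contDiffOn_of_hasFDerivAt_integrand (hT : ContDiffOn ℝ ∞ T U)
    (hK : ∀ i, ContDiffOn ℝ ∞ (K i) U) (hWU : W ⊆ U) (hW : IsOpen W) {α : Fin n ⊕ Fin n}
    {S : Jet n → ℝ} (hS : ∀ z ∈ W, HasFDerivAt S (integrand a T K α z) z) :
    ContDiffOn ℝ ∞ S W := by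
  rw [contDiffOn_infty_iff_fderiv_of_isOpen hW]
  exact ⟨fun z hz => (hS z hz).differentiableAt.differentiableWithinAt,
    ((contDiffOn_integrand hT hK α).mono hWU).congr fun z hz => (hS z hz).fderiv⟩

theorem IsIntegralSystem.fderiv_tuple_generator (hU : IsOpen U) (hT : ContDiffOn ℝ ∞ T U)
    (hK : ∀ i, ContDiffOn ℝ ∞ (K i) U) (hWU : W ⊆ U) (hW : IsOpen W)
    {I : Fin n ⊕ Fin n → Jet n → ℝ} (hI : IsIntegralSystem a T K W I) {z : Jet n} (hz : z ∈ W) :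
    fderiv ℝ (tuple I) z (generator a T K z) = 0 := by
  rw [(hasFDerivAt_tuple hW hI.smooth hz).fderiv]
  ext α
  have h := (applyGenerator_eq_zero_iff hU hT hK hWU hW
    ((hI.smooth α).differentiableOn (by simp))).2 (hI.firstIntegral α) z hz
  rw [applyGenerator_eq] at h
  exact h

end Jet

end

/-! ### The theorem -/

theorem theorem3p2 (n : ℕ) (a : Fin n → Fin n → Fin n → ℝ) (U : Set (Jet n)) (hU : IsOpen U)
    (T : Jet n → ℝ) (K : Fin n → Jet n → ℝ)
    (hT : ContDiffOn ℝ ∞ T U) (hK : ∀ i, ContDiffOn ℝ ∞ (K i) U) :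
    -- the characteristic system can be integrated near each point where the generator is not zero
    (∀ q ∈ U, Jet.generator a T K q ≠ 0 →
      ∃ W ⊆ U, IsOpen W ∧ q ∈ W ∧ ∃ I, Jet.IsIntegralSystem a T K W I) ∧
    -- functions `∫ (Kᵢ dt - T dxᵢ)`, `∫ (Qᵢ dt - T dpᵢ)` are first integrals,
    -- independent where `T ≠ 0`
    (∀ W ⊆ U, IsOpen W → ∀ I : Fin n ⊕ Fin n → Jet n → ℝ,
      (∀ α, ∀ z ∈ W, HasFDerivAt (I α) (Jet.integrand a T K α z) z) →
        (∀ α, Jet.IsFirstIntegral a T K W (I α)) ∧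
        ((∀ z ∈ W, T z ≠ 0) → Jet.IsIntegralSystem a T K W I)) ∧
    -- where `T ≠ 0`, the systems of `2n` independent first integrals are exactly the integrals of
    -- these integrands, combined by an invertible matrix of integrating factors
    (∀ W ⊆ U, IsOpen W → (∀ z ∈ W, T z ≠ 0) → ∀ I : Fin n ⊕ Fin n → Jet n → ℝ,
      (∀ α, ContDiffOn ℝ ∞ (I α) W) →
        (Jet.IsIntegralSystem a T K W I ↔
          ∃ M : Jet n → Matrix (Fin n ⊕ Fin n) (Fin n ⊕ Fin n) ℝ,
            (∀ α β, ContDiffOn ℝ ∞ (fun z => M z α β) W) ∧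
            ∀ z ∈ W, IsUnit (M z).det ∧
              ∀ α, fderiv ℝ (I α) z = ∑ β, M z α β • Jet.integrand a T K β z)) ∧
    -- `v[S] = 0` holds exactly for the first integrals `S`
    (∀ N ⊆ U, IsOpen N → ∀ S : Jet n → ℝ, DifferentiableOn ℝ S N →
      ((∀ z ∈ N, Jet.applyGenerator a T K S z = 0) ↔ Jet.IsFirstIntegral a T K N S)) ∧
    -- every function of first integrals solves `v[S] = 0`, and every solution is locally of this form
    (∀ W ⊆ U, IsOpen W → (∀ z ∈ W, Jet.generator a T K z ≠ 0) →
      ∀ I : Fin n ⊕ Fin n → Jet n → ℝ, Jet.IsIntegralSystem a T K W I →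
        (∀ (r : ℕ∞), 1 ≤ r → ∀ (V : Set (Fin n ⊕ Fin n → ℝ)) (φ : (Fin n ⊕ Fin n → ℝ) → ℝ),
          IsOpen V → ContDiffOn ℝ r φ V →
            ∀ z ∈ W, Jet.tuple I z ∈ V →
              Jet.applyGenerator a T K (fun z' => φ (Jet.tuple I z')) z = 0) ∧
        ∀ W' ⊆ W, IsOpen W' → ∀ q ∈ W', ∃ N ⊆ W', IsOpen N ∧ q ∈ N ∧ IsOpen (Jet.tuple I '' N) ∧
          ∀ (r : ℕ∞), 1 ≤ r → ∀ S : Jet n → ℝ,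
            (ContDiffOn ℝ r S N ∧ ∀ z ∈ N, Jet.applyGenerator a T K S z = 0) ↔
              ∃ φ : (Fin n ⊕ Fin n → ℝ) → ℝ, ContDiffOn ℝ r φ (Jet.tuple I '' N) ∧
                ∀ z ∈ N, S z = φ (Jet.tuple I z)) ∧
    -- where `∂S/∂t ≠ 0`, the equation `S = 0` is solved explicitly by `t = g(x, p)`
    (∀ N ⊆ U, IsOpen N → ∀ (r : ℕ∞), 1 ≤ r → ∀ S : Jet n → ℝ, ContDiffOn ℝ r S N →
      (∀ z ∈ N, Jet.applyGenerator a T K S z = 0) →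
        ∀ q ∈ N, S q = 0 → Jet.pderivT S q ≠ 0 →
          ∃ (A : Set ℝ) (B : Set ((Fin n → ℝ) × (Fin n → ℝ)))
            (g : (Fin n → ℝ) × (Fin n → ℝ) → ℝ),
            IsOpen A ∧ IsOpen B ∧ q ∈ A ×ˢ B ∧ A ×ˢ B ⊆ N ∧ ContDiffOn ℝ r g B ∧ MapsTo g B A ∧
            (∀ t ∈ A, ∀ w ∈ B, S (t, w) = 0 ↔ t = g w) ∧
            ∀ w ∈ B, T (g w, w) = ∑ i, (K i (g w, w) * fderiv ℝ g w (Pi.single i 1, 0) +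
              Jet.coeffP a K i (g w, w) * fderiv ℝ g w (0, Pi.single i 1))) := by
  refine ⟨fun q hq hvq => Jet.exists_isIntegralSystem hU hT hK hq hvq, ?_, ?_,
    fun N hNU hN S hS => Jet.applyGenerator_eq_zero_iff hU hT hK hNU hN hS, ?_, ?_⟩
  · intro W hWU hW I hI
    have hs : ∀ α, ContDiffOn ℝ ∞ (I α) W := fun α =>
      Jet.contDiffOn_of_hasFDerivAt_integrand hT hK hWU hW (hI α)
    -- Exact integrands are the case of the identity matrix.
    refine ⟨fun α => ?_, fun hT0 => Jet.isIntegralSystem_of_fderiv_eq (M := fun _ => 1) hU hT hK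
      hWU hW hs hT0 fun z hz => ⟨by simp, fun α => ?_⟩⟩
    · rw [← Jet.applyGenerator_eq_zero_iff hU hT hK hWU hW ((hs α).differentiableOn (by simp))]
      intro z hz
      rw [Jet.applyGenerator_eq, (hI α z hz).fderiv, Jet.integrand_generator]
    · simp [Matrix.one_apply, (hI α z hz).fderiv]
  · intro W hWU hW hT0 I hs
    refine ⟨fun hI => hI.exists_matrix hU hT hK hWU hW hT0, ?_⟩
    rintro ⟨M, -, hM⟩
    exact Jet.isIntegralSystem_of_fderiv_eq hU hT hK hWU hW hs hT0 hM
  · intro W hWU hW hv I hI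
    have hJ : ContDiffOn ℝ ∞ (Jet.tuple I) W := contDiffOn_pi.2 hI.smooth
    refine ⟨fun r hr V φ hV hφ z hz hzV => ?_, fun W' hW'W hW' q hq => ?_⟩
    · have hr0 : (r : WithTop ℕ∞) ≠ 0 := by
        have : r ≠ 0 := by rintro rfl; simp at hr
        exact_mod_cast this
      have h1 := ((hφ.contDiffAt (hV.mem_nhds hzV)).differentiableAt hr0).hasFDerivAt
      have h2 := ((hJ.contDiffAt (hW.mem_nhds hz)).differentiableAt (by simp)).hasFDerivAt
      have h3 : fderiv ℝ (fun z' => φ (Jet.tuple I z')) z = _ := (h1.comp z h2).fderiv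
      rw [Jet.applyGenerator_eq, h3, ContinuousLinearMap.comp_apply,
        hI.fderiv_tuple_generator hU hT hK hWU hW hz, map_zero]
    · simp only [Jet.applyGenerator_eq]
      -- Applying the factorisation inside `W'` makes the neighbourhood as small as desired.
      refine exists_nhds_factorization Jet.card_add_one_eq_finrank hW' (hJ.mono hW'W)
        (fun z hz => hv z (hW'W hz))
        (fun z hz => hI.fderiv_tuple_generator hU hT hK hWU hW (hW'W hz)) (fun z hz => ?_) hq
      rw [(Jet.hasFDerivAt_tuple hW hI.smooth (hW'W hz)).fderiv,
        ← linearIndependent_iff_surjective_pi]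
      exact hI.independent z (hW'W hz)
  · intro N hNU hN r hr S hS hSv q hq hSq hdS
    obtain ⟨A, B, g, hA, hB, hqAB, hABN, hg, hgA, hgS, hd⟩ :=
      ContDiffOn.exists_implicit_fst hr hS hN hq hSq hdS
    refine ⟨A, B, g, hA, hB, hqAB, hABN, hg, hgA, hgS, fun w hw => ?_⟩
    obtain ⟨h1, h2⟩ := hd w hw
    have h3 := hSv (g w, w) (hABN ⟨hgA hw, hw⟩)
    rw [Jet.applyGenerator_eq] at h3
    have h4 := h2 (Jet.generator a T K (g w, w)).2
    set L := fderiv ℝ S (g w, w)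
    set G := fderiv ℝ g w
    -- Split v into a vector tangent to the graph of `g` and a multiple of ∂/∂t. The derivative of
    -- `S` kills v and the tangent part, hence also the remainder.
    have h5 : (T (g w, w) - G (Jet.generator a T K (g w, w)).2) * L (1, 0) = 0 := by
      have h6 : Jet.generator a T K (g w, w) -
          (G (Jet.generator a T K (g w, w)).2, (Jet.generator a T K (g w, w)).2) =
          (T (g w, w) - G (Jet.generator a T K (g w, w)).2) • ((1, 0) : Jet n) := by
        ext <;> simp [Jet.generator]
      rw [← smul_eq_mul, ← map_smul, ← h6, map_sub, h3, h4, sub_zero]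
    have h7 : T (g w, w) = G (Jet.generator a T K (g w, w)).2 :=
      sub_eq_zero.1 ((mul_eq_zero.1 h5).resolve_right h1)
    have h8 := Jet.clm_apply (G.comp (ContinuousLinearMap.snd ℝ ℝ _))
      (Jet.generator a T K (g w, w))
    have h9 : G ((0 : Fin n → ℝ), (0 : Fin n → ℝ)) = 0 := map_zero G
    simp only [ContinuousLinearMap.comp_apply, ContinuousLinearMap.coe_snd', h9, mul_zero,
      zero_add] at h8
    rw [h7, h8]
    rfl
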